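/- Let $\ell,d\ge 0$ be integers, $N=(\ell+1)(d+1)$, and let $\mathcal{QM}_d(\mathbb P^1,\mathbb P^\ell)\cong\mathbb P^{N-1}$ be the projectivization of the space of $(\ell+1)$-tuples of polynomials $\varphi^j(z)=\sum_{m=0}^d\varphi^j_m z^m$, $j=1,\dots,\ell+1$. Fix a real $r\neq 0$. On $\mathbb C^N$ with coordinates $\varphi^j_m$ take $\Omega=\frac{i}{2}\sum_{j,m}d\varphi^j_m\wedge d\bar\varphi^j_m$, and let $\Omega_{ind}$ be the symplectic form induced on $\mathcal{QM}_d(\mathbb P^1,\mathbb P^\ell)=\{\sum_{j,m}|\varphi^j_m|^2=r^2\}/U_1$ by Hamiltonian reduction with respect to the diagonal $U_1$-action. Let $\mu_{S^1}$ and $\mu_j$ be the functions on this quotient induced by $-\frac12\sum_{j,m}m|\varphi^j_m|^2$ and $-\frac12\sum_m|\varphi^j_m|^2$; they are momenta of the action $\varphi^j_m\mapsto e^{i\alpha_j}e^{im\beta}\varphi^j_m$ of $S^1\times U_1^{\ell+1}$. For $\hbar,\sigma_1,\dots,\sigma_{\ell+1}\in\mathbb R$ the equivariant symplectic volume is $$Z_d=\int_{\mathcal{QM}_d(\mathbb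 P^1,\mathbb P^\ell)}e^{\Omega_{ind}+\hbar\mu_{S^1}+\sum_{j}\sigma_j\mu_j},$$ the integral of the component of top degree, with respect to the complex orientation. Let $\epsilon\in\mathbb R$ satisfy $\epsilon>-(\sigma_j+\hbar m)$ for all $1\le j\le \ell+1$ and $0\le m\le d$ (if $\hbar\ge 0$, this says $\epsilon>\max_j(-\sigma_j)$). Then $$Z_d=(2\pi)^{(\ell+1)(d+1)-2}\int_{\mathbb R-i\epsilon}dH_0\,\frac{e^{\frac{i r^2}{2}H_0}}{\prod_{j=1}^{\ell+1}\prod_{m=0}^{d}(iH_0+\sigma_j+\hbar m)}.$$ The integral over $\mathbb R-i\epsilon$ converges as an improper integral (both ends of the line tending to infinity independently), and absolutely if $(\ell+1)(d+1)\ge 2$. The integral defining $Z_d$, written out in the standard affine charts of $\mathbb P^{N-1}$ with the partition of unity $|\varphi_k|^2/\sum_i|\varphi_i|^2$, converges absolutely in every chart. -/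

import Mathlib

open scoped LinearAlgebra.Projectivization

noncomputable section

namespace Quasimap

/-- Tuples `(φ¹(z), …, φ^{ℓ+1}(z))` of complex polynomials of degree at most `d`. -/
abbrev PolyTuple (ℓ d : ℕ) : Type := Fin (ℓ + 1) → Polynomial.degreeLT ℂ (d + 1)

/-- The quasimap space `𝒬ℳ_d(ℙ¹, ℙ^ℓ)`: the projectivization of the space of `(ℓ+1)`-tuples of
polynomials of degree at most `d`. -/
abbrev QuasimapSpace (ℓ d : ℕ) : Type := ℙ ℂ (PolyTuple ℓ d)

/-- Indices `(j, m)` of the coefficients `φ^j_m` (here `j` starts at `0`). -/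
abbrev Idx (ℓ d : ℕ) : Type := Fin (ℓ + 1) × Fin (d + 1)

/-- The space of coefficient vectors `(φ^j_m)`. -/
abbrev CoeffSpace (ℓ d : ℕ) : Type := Idx ℓ d → ℂ

/-- The coefficients `φ^j_m` of `φ^j(z) = ∑_m φ^j_m z^m`. -/
def coeffs (ℓ d : ℕ) : PolyTuple ℓ d ≃ₗ[ℂ] CoeffSpace ℓ d :=
  (LinearEquiv.piCongrRight fun _ => Polynomial.degreeLTEquiv ℂ (d + 1)).trans
    (LinearEquiv.curry ℂ ℂ (Fin (ℓ + 1)) (Fin (d + 1))).symm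

variable {ℓ d : ℕ}

/-- The point of the quasimap space with homogeneous coordinates `φ`. -/
def toQuasimap (φ : CoeffSpace ℓ d) (hφ : φ ≠ 0) : QuasimapSpace ℓ d :=
  Projectivization.mk ℂ ((coeffs ℓ d).symm φ) (by simpa using hφ)

/-! ### The linear symplectic space -/

/-- The symplectic form `Ω = (i/2) ∑ dφ^j_m ∧ dφ̄^j_m = ∑ dx^j_m ∧ dy^j_m`, `φ = x + iy`. -/
def stdForm (ℓ d : ℕ) : CoeffSpace ℓ d [⋀^Fin 2]→ₗ[ℝ] ℝ where
  toFun v := ∑ i, ((v 0 i).re * (v 1 i).im - (v 0 i).im * (v 1 i).re)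
  map_update_add' v k x y := by
    rw [← Finset.sum_add_distrib]
    refine Finset.sum_congr rfl fun i _ => ?_
    fin_cases k <;> simp <;> ring
  map_update_smul' v k c x := by
    rw [smul_eq_mul, Finset.mul_sum]
    refine Finset.sum_congr rfl fun i _ => ?_
    fin_cases k <;> simp <;> ring
  map_eq_zero_of_eq' v a b h hab := by
    have h01 : v 0 = v 1 := by
      fin_cases a <;> fin_cases b <;> simp_all
    simp [h01, mul_comm]

/-- `∑ |φ^j_m|²`. -/
def normSqSum (φ : CoeffSpace ℓ d) : ℝ := ∑ i, Complex.normSq (φ i)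

/-- The momentum `μ = -½ ∑ |φ^j_m|²` of the diagonal action of `U₁`. -/
def diagMoment (φ : CoeffSpace ℓ d) : ℝ := -(1 / 2) * normSqSum φ

/-- The level set `μ = -r²/2` of the momentum of the diagonal `U₁`, whose quotient by `U₁` is
the quasimap space. -/
def levelSet (ℓ d : ℕ) (r : ℝ) : Set (CoeffSpace ℓ d) := {φ | diagMoment φ + r ^ 2 / 2 = 0}

/-- The momentum `μ_{S¹} = -½ ∑ m |φ^j_m|²` of the rotations `φ^j_m ↦ e^{imβ} φ^j_m`. -/
def rotMoment (φ : CoeffSpace ℓ d) : ℝ :=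
  -(1 / 2) * ∑ j, ∑ m : Fin (d + 1), (m : ℝ) * Complex.normSq (φ (j, m))

/-- The momentum `μ_j = -½ ∑_m |φ^j_m|²` of the `j`-th factor of `U₁^{ℓ+1}`. -/
def factorMoment (j : Fin (ℓ + 1)) (φ : CoeffSpace ℓ d) : ℝ :=
  -(1 / 2) * ∑ m, Complex.normSq (φ (j, m))

/-- The degree-zero part `ħ μ_{S¹} + ∑_j σ_j μ_j` of the equivariant extension of the
symplectic form. -/
def equivMoment (ħ : ℝ) (σ : Fin (ℓ + 1) → ℝ) (φ : CoeffSpace ℓ d) : ℝ :=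
  ħ * rotMoment φ + ∑ j, σ j * factorMoment j φ

theorem normSqSum_pos {φ : CoeffSpace ℓ d} (hφ : φ ≠ 0) : 0 < normSqSum φ := by
  obtain ⟨i, hi⟩ := Function.ne_iff.mp hφ
  exact Finset.sum_pos' (fun i _ => Complex.normSq_nonneg _)
    ⟨i, Finset.mem_univ i, Complex.normSq_pos.mpr hi⟩

theorem normSqSum_smul (c : ℂ) (φ : CoeffSpace ℓ d) :
    normSqSum (c • φ) = Complex.normSq c * normSqSum φ := by
  simp [normSqSum, Finset.mul_sum]

theorem mem_levelSet {r : ℝ} {φ : CoeffSpace ℓ d} : φ ∈ levelSet ℓ d r ↔ normSqSum φ = r ^ 2 := by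
  simp only [levelSet, diagMoment, Set.mem_ofPred_eq]
  constructor <;> intro h <;> linarith

theorem equivMoment_eq (ħ : ℝ) (σ : Fin (ℓ + 1) → ℝ) (φ : CoeffSpace ℓ d) :
    equivMoment ħ σ φ = -(1 / 2) * ∑ i : Idx ℓ d, (σ i.1 + ħ * i.2) * Complex.normSq (φ i) := by
  simp only [equivMoment, rotMoment, factorMoment, Fintype.sum_prod_type, add_mul,
    Finset.mul_sum, ← Finset.sum_add_distrib]
  refine Finset.sum_congr rfl fun j _ => Finset.sum_congr rfl fun m _ => ?_
  ring

/-! ### Hamiltonian reduction -/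

/-- A representative of `p` in the level set. It is unique up to the action of `U₁`. -/
def levelRep (r : ℝ) (p : QuasimapSpace ℓ d) : CoeffSpace ℓ d :=
  (r / √(normSqSum (coeffs ℓ d p.rep))) • coeffs ℓ d p.rep

/-- The function `ħ μ_{S¹} + ∑_j σ_j μ_j` on the reduced space, i.e. the `U₁`-invariant function
`equivMoment` restricted to the level set and descended to the quotient. -/
def redMoment (r ħ : ℝ) (σ : Fin (ℓ + 1) → ℝ) (p : QuasimapSpace ℓ d) : ℝ :=
  equivMoment ħ σ (levelRep r p)

/-- The reduced function at the point with homogeneous coordinates `φ` in the level set is the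
original function at `φ`. -/
theorem redMoment_toQuasimap (r ħ : ℝ) (σ : Fin (ℓ + 1) → ℝ) (φ : CoeffSpace ℓ d) (hφ : φ ≠ 0)
    (hr : φ ∈ levelSet ℓ d r) : redMoment r ħ σ (toQuasimap φ hφ) = equivMoment ħ σ φ := by
  obtain ⟨a, ha⟩ := Projectivization.exists_smul_eq_mk_rep ℂ ((coeffs ℓ d).symm φ)
    (by simpa using hφ)
  have hrep : coeffs ℓ d (toQuasimap φ hφ).rep = (a : ℂ) • φ := by
    rw [toQuasimap, ← ha, Units.smul_def, map_smul, LinearEquiv.apply_symm_apply]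
  have hpos : 0 < Complex.normSq (a : ℂ) := Complex.normSq_pos.mpr a.ne_zero
  have hn : 0 < normSqSum φ := normSqSum_pos hφ
  rw [mem_levelSet] at hr
  rw [redMoment, levelRep, hrep, equivMoment_eq, equivMoment_eq, normSqSum_smul]
  congr 1
  refine Finset.sum_congr rfl fun i _ => ?_
  have hc : (r / √(Complex.normSq a * normSqSum φ)) ^ 2 * Complex.normSq a = 1 := by
    rw [div_pow, Real.sq_sqrt (by positivity), ← hr]
    field_simp
  have : Complex.normSq (((r / √(Complex.normSq a * normSqSum φ)) • (a : ℂ) • φ) i)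
      = (r / √(Complex.normSq a * normSqSum φ)) ^ 2 * Complex.normSq a * Complex.normSq (φ i) := by
    simp [Complex.real_smul, Complex.normSq_ofReal]
    ring
  rw [this, hc, one_mul]

/-- Indices of the inhomogeneous coordinates `w_i = φ_i / φ_k` (`i ≠ k`) of the chart
`φ_k ≠ 0`. -/
abbrev ChartIdx (k : Idx ℓ d) : Type := {i : Idx ℓ d // i ≠ k}

/-- The space of inhomogeneous coordinates of the chart `φ_k ≠ 0`. -/
abbrev ChartSpace (k : Idx ℓ d) : Type := ChartIdx k → ℂ

/-- Homogeneous coordinates, with `φ_k = 1`, of the point with inhomogeneous coordinates `w`. -/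
def homog (k : Idx ℓ d) (w : ChartSpace k) : CoeffSpace ℓ d :=
  fun i => if h : i = k then 1 else w ⟨i, h⟩

theorem homog_ne_zero (k : Idx ℓ d) (w : ChartSpace k) : homog k w ≠ 0 := fun h => by
  simpa [homog] using congrFun h k

/-- The inverse of the affine chart `φ_k ≠ 0` of the quasimap space. -/
def chartInv (k : Idx ℓ d) (w : ChartSpace k) : QuasimapSpace ℓ d :=
  toQuasimap (homog k w) (homog_ne_zero k w)

/-- A smooth section, over the affine chart `φ_k ≠ 0`, of the principal `U₁`-bundle
`levelSet r → levelSet r / U₁`. -/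
def levelSection (r : ℝ) (k : Idx ℓ d) (w : ChartSpace k) : CoeffSpace ℓ d :=
  (r / √(normSqSum (homog k w))) • homog k w

theorem levelSection_mem (r : ℝ) (k : Idx ℓ d) (w : ChartSpace k) :
    levelSection r k w ∈ levelSet ℓ d r := by
  have hn := normSqSum_pos (homog_ne_zero k w)
  have : levelSection r k w = ((r / √(normSqSum (homog k w)) : ℝ) : ℂ) • homog k w := by
    ext i; simp [levelSection]
  rw [mem_levelSet, this, normSqSum_smul, Complex.normSq_ofReal, ← sq, div_pow,
    Real.sq_sqrt hn.le]
  field_simp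

theorem toQuasimap_levelSection {r : ℝ} (k : Idx ℓ d) (w : ChartSpace k)
    (h : levelSection r k w ≠ 0) : toQuasimap (levelSection r k w) h = chartInv k w := by
  have : levelSection r k w = ((r / √(normSqSum (homog k w)) : ℝ) : ℂ) • homog k w := by
    ext i; simp [levelSection]
  refine (Projectivization.mk_eq_mk_iff' ℂ _ _ _ _).mpr
    ⟨((r / √(normSqSum (homog k w)) : ℝ) : ℂ), ?_⟩
  rw [← map_smul, this]

/-- The reduced symplectic form `Ω_ind` in the affine chart `φ_k ≠ 0`. It is determined by
`π^* Ω_ind = ι^* Ω`, where `ι` is the inclusion of the level set and `π` its projection to the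
quotient; hence in the chart it is the pullback of `Ω` along any section of `π`. -/
def reducedForm (r : ℝ) (k : Idx ℓ d) (w : ChartSpace k) : ChartSpace k [⋀^Fin 2]→ₗ[ℝ] ℝ :=
  (stdForm ℓ d).compLinearMap (fderiv ℝ (levelSection r k) w).toLinearMap

/-! ### Integration over the quasimap space -/

/-- The value of `ω^{∧n} / n!`, for a 2-form `ω`, on the `2n` vectors
`b (j, 0), b (j, 1)` (`j ∈ J`, `n = |J|`). It does not depend on the order in which the pairs
are listed. -/
def dividedWedgePow {E J : Type*} [AddCommGroup E] [Module ℝ E] [Fintype J] [DecidableEq J]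
    (ω : E [⋀^Fin 2]→ₗ[ℝ] ℝ) (b : J × Fin 2 → E) : ℝ :=
  (1 / (2 ^ Fintype.card J * (Fintype.card J).factorial)) *
    ∑ s : Equiv.Perm (J × Fin 2),
      ((Equiv.Perm.sign s : ℤ) : ℝ) * ∏ j, ω ![b (s (j, 0)), b (s (j, 1))]

/-- The oriented real basis `∂/∂x_i, ∂/∂y_i` (`w_i = x_i + i y_i`) of the chart space. -/
def realFrame (k : Idx ℓ d) (a : ChartIdx k × Fin 2) : ChartSpace k :=
  Pi.single a.1 (if a.2 = 0 then 1 else Complex.I)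

/-- The coefficient with respect to `∏ dx_i ∧ dy_i`, in the chart `φ_k ≠ 0`, of the
top-degree component of the inhomogeneous form `exp (Ω_ind + f)`, where `f` is a function
on the quasimap space. With `n` the complex dimension this component is `e^f Ω_ind^{∧n} / n!`. -/
def expTopCoeff (r : ℝ) (f : QuasimapSpace ℓ d → ℝ) (k : Idx ℓ d) (w : ChartSpace k) : ℝ :=
  Real.exp (f (chartInv k w)) * dividedWedgePow (reducedForm r k w) (realFrame k)

/-- The partition of unity `|φ_k|² / ∑_i |φ_i|²` on the quasimap space, indexed by its affine
charts; the `k`-th function vanishes outside the `k`-th chart. -/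
def chartWeight (k : Idx ℓ d) (p : QuasimapSpace ℓ d) : ℝ :=
  Complex.normSq (coeffs ℓ d p.rep k) / normSqSum (coeffs ℓ d p.rep)

/-- The contribution to the integrand of the equivariant volume of the `k`-th affine chart. -/
def volumeIntegrand (r ħ : ℝ) (σ : Fin (ℓ + 1) → ℝ) (k : Idx ℓ d) (w : ChartSpace k) : ℝ :=
  chartWeight k (chartInv k w) * expTopCoeff r (redMoment r ħ σ) k w

variable (ℓ d) in
/-- The `S¹ × U₁^{ℓ+1}`-equivariant symplectic volume
`Z_d = ∫ exp (Ω_ind + ħ μ_{S¹} + ∑_j σ_j μ_j)` of the quasimap space, the integral of the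
top-degree component over the complex manifold, computed with the partition of unity
`chartWeight`. -/
def equivariantVolume (r ħ : ℝ) (σ : Fin (ℓ + 1) → ℝ) : ℝ :=
  ∑ k : Idx ℓ d, ∫ w : ChartSpace k, volumeIntegrand r ħ σ k w

variable (d) in
/-- `e^{i r² H / 2} / ∏_j ∏_{m=0}^d (i H + σ_j + ħ m)`. -/
def contourIntegrand (r ħ : ℝ) (σ : Fin (ℓ + 1) → ℝ) (H : ℂ) : ℂ :=
  Complex.exp (Complex.I * r ^ 2 / 2 * H) /
    ∏ j, ∏ m ∈ Finset.range (d + 1), (Complex.I * H + σ j + ħ * m)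

end Quasimap

end

noncomputable section

namespace Quasimap

/-! ### The top divided power of a 2-form -/

section DividedWedgePow

variable {E J : Type*} [AddCommGroup E] [Module ℝ E] [Fintype J] [DecidableEq J]

/-! Write λ_i = σ_j + ħm for i = (j, m), s = r²/2 and N = (ℓ+1)(d+1). Over the chart φ_k ≠ 0 the
level set has a section whose k-th coordinate is real, so that coordinate drops out of Ω, and the
others, z = r w/√(1+|w|²), are Darboux coordinates mapping the chart onto the ball |z| < |r|
(`reducedForm_eq`, `range_darboux`). There Ω_ind^n/n! becomes Lebesgue measure. With u = s - |z|²/2,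
the partition function is u/s, so each chart contributes s⁻¹ ∫ u₊ e^{-λ_k u} ∏_{i≠k}
e^{-λ_i|z_i|²/2} dz (`volumeIntegrand_eq`).

Since u + |z|²/2 = s, replacing every λ_i by a_i = λ_i + ε > 0 only costs a factor e^{εs}. Fourier
inversion turns u₊ e^{-a_k u} into (2π)⁻¹ ∫ e^{ixu} (ix+a_k)⁻² dx. After Fubini the Gaussians in z
give 2π/(ix+a_i) each, leaving (2π)^{N-2} s⁻¹ ∫ e^{ixs} (ix+a_k)⁻¹ ∏_i (ix+a_i)⁻¹ dx
(`integral_max_mul_exp_mul_gaussian`, `integral_darbouxDensity`).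

Summing over k produces the logarithmic derivative of the product of poles. Integration by parts
turns it into s times the contour integral with H = x - iε, which cancels s⁻¹
(`tendsto_intervalIntegral_exp_mul_prod_inv`). The boundary terms decay even for a single pole, so N
= 1 is covered as an improper integral. -/

theorem prod_update_pair (ω : E [⋀^Fin 2]→ₗ[ℝ] ℝ) (v : J × Fin 2 → E) (p : J × Fin 2) (x : E) :
    ∏ j, ω (fun c => Function.update v p x (j, c)) =
      ω (Function.update (fun c => v (p.1, c)) p.2 x) *
        ∏ j ∈ Finset.univ.erase p.1, ω (fun c => v (j, c)) := by
  rw [← Finset.mul_prod_erase _ _ (Finset.mem_univ p.1)]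
  congr 1
  · congr 1
    ext c
    by_cases h : c = p.2
    · subst h; simp
    · have : (p.1, c) ≠ p := fun h' => h (congrArg Prod.snd h')
      simp [h, this]
  · refine Finset.prod_congr rfl fun j hj => ?_
    congr 1
    ext c
    have : (j, c) ≠ p := fun h' => (Finset.mem_erase.mp hj).1 (congrArg Prod.fst h')
    simp [this]

/-- The multilinear map `v ↦ ∏ j, ω (v (j, 0), v (j, 1))`. -/
def pairProd (J : Type*) [Fintype J] [DecidableEq J] (ω : E [⋀^Fin 2]→ₗ[ℝ] ℝ) :
    MultilinearMap ℝ (fun _ : J × Fin 2 => E) ℝ :=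
  MultilinearMap.mk' (fun v => ∏ j, ω (fun c => v (j, c)))
    (fun v p x y => by simp only [prod_update_pair, AlternatingMap.map_update_add, add_mul])
    (fun v p a x => by
      simp only [prod_update_pair, AlternatingMap.map_update_smul, smul_eq_mul, mul_assoc])

theorem dividedWedgePow_eq_alternatization (ω : E [⋀^Fin 2]→ₗ[ℝ] ℝ) (b : J × Fin 2 → E) :
    dividedWedgePow ω b = (1 / (2 ^ Fintype.card J * (Fintype.card J).factorial)) *
      MultilinearMap.alternatization (pairProd J ω) b := by
  rw [dividedWedgePow, MultilinearMap.alternatization_apply]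
  congr 1
  refine Finset.sum_congr rfl fun s _ => ?_
  rw [MultilinearMap.domDomCongr_apply, Units.smul_def, zsmul_eq_mul]
  congr 1
  refine Finset.prod_congr rfl fun j _ => ?_
  congr 1
  ext c
  fin_cases c <;> rfl

/-- The alternatization takes as many arguments as the dimension of E, so it is a multiple of the
determinant in the basis b. -/
theorem dividedWedgePow_compLinearMap (ω : E [⋀^Fin 2]→ₗ[ℝ] ℝ) (A : E →ₗ[ℝ] E)
    (b : Module.Basis (J × Fin 2) ℝ E) :
    dividedWedgePow (ω.compLinearMap A) b = LinearMap.det A * dividedWedgePow ω b := by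
  have h : dividedWedgePow (ω.compLinearMap A) b = dividedWedgePow ω (A ∘ b) := by
    simp only [dividedWedgePow, AlternatingMap.compLinearMap_apply]
    congr 1
    refine Finset.sum_congr rfl fun s _ => ?_
    congr 1
    refine Finset.prod_congr rfl fun j _ => ?_
    congr 1
    ext c
    fin_cases c <;> rfl
  rw [h, dividedWedgePow_eq_alternatization, dividedWedgePow_eq_alternatization,
    AlternatingMap.eq_smul_basis_det b (MultilinearMap.alternatization (pairProd J ω)),
    AlternatingMap.smul_apply, AlternatingMap.smul_apply, Module.Basis.det_comp,
    Module.Basis.det_self, smul_eq_mul, smul_eq_mul]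
  ring

/-- The permutation `(j, c) ↦ (π j, f j c)` of `J × Fin 2`. -/
def pairPerm (q : Equiv.Perm J × (J → Equiv.Perm (Fin 2))) : Equiv.Perm (J × Fin 2) :=
  Equiv.prodCongrLeft (fun _ => q.1) * Equiv.prodCongrRight q.2

theorem pairPerm_apply {J : Type*} (q : Equiv.Perm J × (J → Equiv.Perm (Fin 2))) (p : J × Fin 2) :
    pairPerm q p = (q.1 p.1, q.2 p.1 p.2) := by
  rfl

theorem pairPerm_injective {J : Type*} : Function.Injective (pairPerm (J := J)) := by
  intro q q' h
  have h' : ∀ j c, (q.1 j, q.2 j c) = (q'.1 j, q'.2 j c) := fun j c => by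
    simpa [pairPerm_apply] using congrArg (fun e : Equiv.Perm (J × Fin 2) => e (j, c)) h
  refine Prod.ext (Equiv.ext fun j => (Prod.ext_iff.mp (h' j 0)).1)
    (funext fun j => Equiv.ext fun c => (Prod.ext_iff.mp (h' j c)).2)

/-- Permuting the pairs acts in the same way on both copies of J, so its sign occurs squared. -/
theorem sign_pairPerm (q : Equiv.Perm J × (J → Equiv.Perm (Fin 2))) :
    Equiv.Perm.sign (pairPerm q) = ∏ j, Equiv.Perm.sign (q.2 j) := by
  rw [pairPerm, Equiv.Perm.sign_mul, Equiv.Perm.sign_prodCongrLeft, Equiv.Perm.sign_prodCongrRight,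
    Fin.prod_univ_two, ← sq, Int.units_sq, one_mul]

omit [DecidableEq J] in
theorem exists_pairPerm_eq {s : Equiv.Perm (J × Fin 2)}
    (h : ∀ j, (s (j, 0)).1 = (s (j, 1)).1) : ∃ q, pairPerm q = s := by
  have hc : ∀ j c, (s (j, c)).1 = (s (j, 0)).1 := fun j c => by
    fin_cases c
    · rfl
    · exact (h j).symm
  have hinj2 : ∀ j, Function.Injective fun c => (s (j, c)).2 := fun j c c' hcc => by
    have : s (j, c) = s (j, c') := Prod.ext ((hc j c).trans (hc j c').symm) hcc
    exact (Prod.ext_iff.mp (s.injective this)).2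
  have hinj1 : Function.Injective fun j => (s (j, 0)).1 := fun j j' hjj => by
    obtain ⟨c, hcc⟩ := (Finite.injective_iff_surjective.mp (hinj2 j)) (s (j', 0)).2
    have : s (j, c) = s (j', 0) := Prod.ext ((hc j c).trans hjj) hcc
    exact (Prod.ext_iff.mp (s.injective this)).1
  refine ⟨(Equiv.ofBijective _ (Finite.injective_iff_bijective.mp hinj1),
    fun j => Equiv.ofBijective _ (Finite.injective_iff_bijective.mp (hinj2 j))), ?_⟩
  ext1 ⟨j, c⟩
  rw [pairPerm_apply]
  exact Prod.ext (hc j c).symm rfl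

/-- The top divided power of a 2-form takes the value `1` on a symplectic basis. -/
theorem dividedWedgePow_eq_one {ω : E [⋀^Fin 2]→ₗ[ℝ] ℝ} {b : J × Fin 2 → E}
    (h0 : ∀ p q : J × Fin 2, p.1 ≠ q.1 → ω ![b p, b q] = 0)
    (h1 : ∀ j, ω ![b (j, 0), b (j, 1)] = 1) : dividedWedgePow ω b = 1 := by
  have hflip : ∀ (j : J) (f : Equiv.Perm (Fin 2)),
      ω ![b (j, f 0), b (j, f 1)] = ((Equiv.Perm.sign f : ℤ) : ℝ) := fun j f => by
    have hm := ω.map_perm ![b (j, 0), b (j, 1)] f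
    rw [h1, Units.smul_def, zsmul_eq_mul, mul_one] at hm
    rw [← hm]
    congr 1
    ext c
    have key : ∀ a : Fin 2, ![b (j, 0), b (j, 1)] a = b (j, a) := fun a => by
      fin_cases a <;> rfl
    fin_cases c <;> simp [key]
  have hsum : ∑ s : Equiv.Perm (J × Fin 2),
      ((Equiv.Perm.sign s : ℤ) : ℝ) * ∏ j, ω ![b (s (j, 0)), b (s (j, 1))]
      = ∑ q : Equiv.Perm J × (J → Equiv.Perm (Fin 2)), (1 : ℝ) := by
    symm
    -- A permutation separating some pair contributes 0. One preserving the pairs contributes its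
    -- sign squared, and there are n!·2^n of these, which cancels the normalization.
    refine Finset.sum_of_injOn pairPerm pairPerm_injective.injOn (by simp) ?_ ?_
    · intro s _ hs
      have : ∃ j, (s (j, 0)).1 ≠ (s (j, 1)).1 := by
        by_contra! hcon
        obtain ⟨q, hq⟩ := exists_pairPerm_eq hcon
        exact hs ⟨q, by simp, hq⟩
      obtain ⟨j, hj⟩ := this
      rw [Finset.prod_eq_zero (Finset.mem_univ j) (h0 _ _ hj), mul_zero]
    · intro q _
      simp only [sign_pairPerm, pairPerm_apply, hflip]
      rw [Units.coe_prod, Int.cast_prod, ← Finset.prod_mul_distrib]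
      refine (Finset.prod_eq_one fun j _ => ?_).symm
      rw [← Int.cast_mul, ← Units.val_mul, ← sq, Int.units_sq]
      simp
  rw [dividedWedgePow, hsum]
  simp [Fintype.card_perm, Fintype.card_pi]
  field_simp

end DividedWedgePow

variable {ℓ d : ℕ}

/-! ### The reduced form in Darboux coordinates -/

/-- `∑ |z_i|²` on the chart space. -/
def chartNormSq {k : Idx ℓ d} (z : ChartSpace k) : ℝ := ∑ i, Complex.normSq (z i)

theorem chartNormSq_nonneg {k : Idx ℓ d} (z : ChartSpace k) : 0 ≤ chartNormSq z :=
  Finset.sum_nonneg fun _ _ => Complex.normSq_nonneg _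

theorem chartNormSq_smul {k : Idx ℓ d} (c : ℝ) (z : ChartSpace k) :
    chartNormSq (c • z) = c ^ 2 * chartNormSq z := by
  simp [chartNormSq, Finset.mul_sum, Complex.normSq_ofReal, sq]

theorem sum_eq_add_sum_chartIdx (k : Idx ℓ d) (f : Idx ℓ d → ℝ) :
    ∑ i, f i = f k + ∑ i : ChartIdx k, f i :=
  Fintype.sum_eq_add_sum_subtype_ne f k

theorem homog_self (k : Idx ℓ d) (w : ChartSpace k) : homog k w k = 1 := by simp [homog]

theorem homog_coe (k : Idx ℓ d) (w : ChartSpace k) (i : ChartIdx k) : homog k w i = w i := by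
  simp [homog, i.2]

theorem normSqSum_homog (k : Idx ℓ d) (w : ChartSpace k) :
    normSqSum (homog k w) = 1 + chartNormSq w := by
  rw [normSqSum, sum_eq_add_sum_chartIdx k]
  simp [homog_self, homog_coe, chartNormSq]

/-- The radial factor `r / √(1 + |w|²)` of the section of the level set. -/
def radialFactor (r : ℝ) {k : Idx ℓ d} (w : ChartSpace k) : ℝ := r / √(1 + chartNormSq w)

theorem levelSection_eq (r : ℝ) (k : Idx ℓ d) (w : ChartSpace k) :
    levelSection r k w = radialFactor r w • homog k w := by
  rw [levelSection, normSqSum_homog, radialFactor]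

theorem radialFactor_sq (r : ℝ) {k : Idx ℓ d} (w : ChartSpace k) :
    radialFactor r w ^ 2 = r ^ 2 / (1 + chartNormSq w) := by
  rw [radialFactor, div_pow, Real.sq_sqrt (by linarith [chartNormSq_nonneg w])]

/-- The real part of the standard Hermitian form, as a functional of the second argument. -/
def reInner {k : Idx ℓ d} (w : ChartSpace k) : ChartSpace k →L[ℝ] ℝ :=
  ∑ i, ((w i).re • Complex.reCLM.comp (ContinuousLinearMap.proj i) +
    (w i).im • Complex.imCLM.comp (ContinuousLinearMap.proj i))

theorem reInner_apply {k : Idx ℓ d} (w u : ChartSpace k) :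
    reInner w u = ∑ i, ((w i).re * (u i).re + (w i).im * (u i).im) := by
  simp [reInner]

theorem reInner_self {k : Idx ℓ d} (w : ChartSpace k) : reInner w w = chartNormSq w := by
  simp [reInner_apply, chartNormSq, Complex.normSq_apply]

theorem hasFDerivAt_chartNormSq {k : Idx ℓ d} (w : ChartSpace k) :
    HasFDerivAt (chartNormSq (k := k)) ((2 : ℝ) • reInner w) w := by
  have hre : ∀ i : ChartIdx k, HasFDerivAt (fun z : ChartSpace k => (z i).re)
      (Complex.reCLM.comp (ContinuousLinearMap.proj (R := ℝ) (φ := fun _ : ChartIdx k => ℂ) i)) w :=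
    fun i => (Complex.reCLM.comp
      (ContinuousLinearMap.proj (R := ℝ) (φ := fun _ : ChartIdx k => ℂ) i)).hasFDerivAt
  have him : ∀ i : ChartIdx k, HasFDerivAt (fun z : ChartSpace k => (z i).im)
      (Complex.imCLM.comp (ContinuousLinearMap.proj (R := ℝ) (φ := fun _ : ChartIdx k => ℂ) i)) w :=
    fun i => (Complex.imCLM.comp
      (ContinuousLinearMap.proj (R := ℝ) (φ := fun _ : ChartIdx k => ℂ) i)).hasFDerivAt
  have h := HasFDerivAt.fun_sum (u := Finset.univ) fun i _ =>
    ((hre i).mul (hre i)).add ((him i).mul (him i))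
  refine (h.congr_fderiv ?_).congr_of_eventuallyEq (Filter.Eventually.of_forall fun z => ?_)
  · ext u
    simp [reInner, Finset.mul_sum]
    refine Finset.sum_congr rfl fun i _ => ?_
    ring
  · simp [chartNormSq, Complex.normSq_apply]

/-- The derivative of `radialFactor`. -/
def radialFactorDeriv (r : ℝ) {k : Idx ℓ d} (w : ChartSpace k) : ChartSpace k →L[ℝ] ℝ :=
  (-(radialFactor r w / (1 + chartNormSq w))) • reInner w

theorem hasFDerivAt_radialFactor (r : ℝ) {k : Idx ℓ d} (w : ChartSpace k) :
    HasFDerivAt (radialFactor r (k := k)) (radialFactorDeriv r w) w := by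
  have hS : 0 < 1 + chartNormSq w := by linarith [chartNormSq_nonneg w]
  have hs : √(1 + chartNormSq w) ≠ 0 := (Real.sqrt_pos.mpr hS).ne'
  have h1 : HasDerivAt (fun x : ℝ => r / √(1 + x))
      (-(radialFactor r w / (1 + chartNormSq w)) / 2) (chartNormSq w) := by
    have h := (((hasDerivAt_id (chartNormSq w)).const_add 1).sqrt hS.ne').fun_inv hs
    refine (h.const_mul r).congr_deriv ?_
    rw [radialFactor, id, Real.sq_sqrt hS.le]
    field_simp
  refine (h1.comp_hasFDerivAt w (hasFDerivAt_chartNormSq w)).congr_fderiv ?_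
  rw [radialFactorDeriv, smul_smul]
  congr 1
  ring

/-- Extension of a chart vector by `0` in the `k`-th place. -/
def extendZero (k : Idx ℓ d) : ChartSpace k →L[ℝ] CoeffSpace ℓ d :=
  ContinuousLinearMap.pi fun i => if h : i = k then 0 else ContinuousLinearMap.proj ⟨i, h⟩

theorem extendZero_self (k : Idx ℓ d) (u : ChartSpace k) : extendZero k u k = 0 := by
  simp [extendZero]

theorem extendZero_coe (k : Idx ℓ d) (u : ChartSpace k) (i : ChartIdx k) :
    extendZero k u i = u i := by
  simp [extendZero, i.2]

theorem hasFDerivAt_homog (k : Idx ℓ d) (w : ChartSpace k) :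
    HasFDerivAt (homog k) (extendZero k) w := by
  have h : homog k = fun w => extendZero k w + homog k 0 := by
    ext w i
    by_cases hi : i = k
    · subst hi; simp [extendZero_self, homog_self]
    · simp [homog, extendZero, hi]
  rw [h]
  exact (extendZero k).hasFDerivAt.add_const _

/-- The map `w ↦ r w / √(1 + |w|²)` from the affine chart onto the ball of radius `|r|`: the
coordinates other than the `k`-th of the section of the level set. They are Darboux coordinates
of the reduced form. -/
def darboux (r : ℝ) {k : Idx ℓ d} (w : ChartSpace k) : ChartSpace k := radialFactor r w • w

/-- The derivative of `darboux`. -/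
def darbouxDeriv (r : ℝ) {k : Idx ℓ d} (w : ChartSpace k) : ChartSpace k →L[ℝ] ChartSpace k :=
  radialFactor r w • ContinuousLinearMap.id ℝ _ + (radialFactorDeriv r w).smulRight w

theorem hasFDerivAt_darboux (r : ℝ) {k : Idx ℓ d} (w : ChartSpace k) :
    HasFDerivAt (darboux r (k := k)) (darbouxDeriv r w) w :=
  (hasFDerivAt_radialFactor r w).smul (hasFDerivAt_id w)

theorem fderiv_levelSection (r : ℝ) (k : Idx ℓ d) (w : ChartSpace k) :
    fderiv ℝ (levelSection r k) w =
      radialFactor r w • extendZero k + (radialFactorDeriv r w).smulRight (homog k w) := by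
  rw [show levelSection r k = fun w => radialFactor r w • homog k w from
    funext (levelSection_eq r k)]
  exact ((hasFDerivAt_radialFactor r w).smul (hasFDerivAt_homog k w)).fderiv

/-- The standard symplectic form of the chart space. -/
def chartForm (k : Idx ℓ d) : ChartSpace k [⋀^Fin 2]→ₗ[ℝ] ℝ :=
  (stdForm ℓ d).compLinearMap (extendZero k).toLinearMap

theorem chartForm_apply (k : Idx ℓ d) (v : Fin 2 → ChartSpace k) :
    chartForm k v = ∑ i, ((v 0 i).re * (v 1 i).im - (v 0 i).im * (v 1 i).re) := by
  change ∑ i, ((extendZero k (v 0) i).re * (extendZero k (v 1) i).im -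
    (extendZero k (v 0) i).im * (extendZero k (v 1) i).re) = _
  rw [sum_eq_add_sum_chartIdx k]
  simp [extendZero_self, extendZero_coe]

/-- The k-th coordinate of the section stays real, so its derivative has no imaginary part and its
term in Ω vanishes. -/
theorem reducedForm_eq (r : ℝ) (k : Idx ℓ d) (w : ChartSpace k) :
    reducedForm r k w = (chartForm k).compLinearMap (darbouxDeriv r w).toLinearMap := by
  ext v
  rw [reducedForm, fderiv_levelSection, AlternatingMap.compLinearMap_apply,
    AlternatingMap.compLinearMap_apply, chartForm_apply]
  change ∑ i, _ = _
  rw [sum_eq_add_sum_chartIdx k]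
  simp [extendZero_self, extendZero_coe, homog_self, homog_coe, darbouxDeriv]

/-- `realFrame` as a basis. -/
def realBasis (k : Idx ℓ d) : Module.Basis (ChartIdx k × Fin 2) ℝ (ChartSpace k) :=
  (Pi.basis fun _ : ChartIdx k => Complex.basisOneI).reindex (Equiv.sigmaEquivProd _ _)

theorem coe_realBasis (k : Idx ℓ d) : ⇑(realBasis k) = realFrame k := by
  ext1 ⟨i, c⟩
  rw [realBasis, Module.Basis.reindex_apply, realFrame]
  simp only [Equiv.sigmaEquivProd_symm_apply, Pi.basis_apply, Complex.coe_basisOneI]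
  fin_cases c <;> simp

theorem dividedWedgePow_chartForm (k : Idx ℓ d) :
    dividedWedgePow (chartForm k) (realFrame k) = 1 := by
  apply dividedWedgePow_eq_one
  · rintro ⟨i, a⟩ ⟨j, b⟩ hij
    rw [chartForm_apply]
    refine Finset.sum_eq_zero fun x _ => ?_
    rcases eq_or_ne x i with rfl | hx
    · have : x ≠ j := hij
      simp [realFrame, this]
    · simp [realFrame, hx]
  · intro j
    rw [chartForm_apply, Finset.sum_eq_single j]
    · simp [realFrame]
    · intro i _ hi; simp [realFrame, hi]
    · simp

theorem dividedWedgePow_reducedForm (r : ℝ) (k : Idx ℓ d) (w : ChartSpace k) :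
    dividedWedgePow (reducedForm r k w) (realFrame k) = (darbouxDeriv r w).det := by
  rw [reducedForm_eq, ← coe_realBasis, dividedWedgePow_compLinearMap, coe_realBasis,
    dividedWedgePow_chartForm, mul_one]

/-- The derivative is the radial factor times a transvection of determinant 1 - |w|²/(1+|w|²) =
1/(1+|w|²). This is where the chart orientation agrees with that of the Darboux coordinates. -/
theorem det_darbouxDeriv_nonneg {r : ℝ} (hr : r ≠ 0) {k : Idx ℓ d} (w : ChartSpace k) :
    0 ≤ (darbouxDeriv r w).det := by
  have hS : 0 < 1 + chartNormSq w := by linarith [chartNormSq_nonneg w]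
  have hρ : radialFactor r w ≠ 0 := div_ne_zero hr (Real.sqrt_pos.mpr hS).ne'
  have h : (darbouxDeriv r w).toLinearMap = radialFactor r w •
      LinearMap.transvection ((-(1 / (1 + chartNormSq w))) • (reInner w).toLinearMap) w := by
    refine LinearMap.ext fun u => ?_
    simp only [darbouxDeriv, radialFactorDeriv, LinearMap.transvection.apply,
      LinearMap.smul_apply, ContinuousLinearMap.coe_coe, add_apply,
      smul_apply, ContinuousLinearMap.smulRight_apply,
      ContinuousLinearMap.id_apply, smul_add, smul_smul, smul_eq_mul]
    congr 2
    ring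
  -- The real dimension is even, so the power of the radial factor is nonnegative even when r < 0.
  have hfin : Module.finrank ℝ (ChartSpace k) = 2 * Fintype.card (ChartIdx k) := by
    rw [Module.finrank_pi_fintype]
    simp [Complex.finrank_real_complex, mul_comm]
  rw [ContinuousLinearMap.det, h, LinearMap.det_smul, LinearMap.transvection.det, hfin, pow_mul]
  refine mul_nonneg (by positivity) ?_
  rw [LinearMap.smul_apply, ContinuousLinearMap.coe_coe, reInner_self, smul_eq_mul]
  have : 1 + -(1 / (1 + chartNormSq w)) * chartNormSq w = 1 / (1 + chartNormSq w) := by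
    field_simp; ring
  rw [this]
  positivity

/-! ### The Darboux map as a bijection onto the open ball -/

theorem chartNormSq_darboux (r : ℝ) {k : Idx ℓ d} (w : ChartSpace k) :
    chartNormSq (darboux r w) = r ^ 2 - r ^ 2 / (1 + chartNormSq w) := by
  have hS : 0 < 1 + chartNormSq w := by linarith [chartNormSq_nonneg w]
  rw [darboux, chartNormSq_smul, radialFactor_sq]
  field_simp; ring

/-- The norm of the image determines |w|, hence the radial factor, hence w. -/
theorem darboux_injective {r : ℝ} (hr : r ≠ 0) {k : Idx ℓ d} :
    Function.Injective (darboux r (k := k)) := by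
  intro w w' h
  have hS : 0 < 1 + chartNormSq w := by linarith [chartNormSq_nonneg w]
  have hS' : 0 < 1 + chartNormSq w' := by linarith [chartNormSq_nonneg w']
  have hq := congrArg chartNormSq h
  rw [chartNormSq_darboux, chartNormSq_darboux] at hq
  have hq' : chartNormSq w = chartNormSq w' := by
    have : r ^ 2 / (1 + chartNormSq w) = r ^ 2 / (1 + chartNormSq w') := by linarith
    rw [div_eq_div_iff hS.ne' hS'.ne'] at this
    have := mul_left_cancel₀ (pow_ne_zero 2 hr) this
    linarith
  have hρ : radialFactor r w' ≠ 0 := div_ne_zero hr (Real.sqrt_pos.mpr hS').ne'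
  refine smul_right_injective _ hρ ?_
  simp only [darboux] at h
  change radialFactor r w' • w = radialFactor r w' • w'
  rw [← h, radialFactor, radialFactor, hq']

theorem range_darboux {r : ℝ} (hr : r ≠ 0) (k : Idx ℓ d) :
    Set.range (darboux r (k := k)) = {z | chartNormSq z < r ^ 2} := by
  ext z
  constructor
  · rintro ⟨w, rfl⟩
    have hS : 0 < 1 + chartNormSq w := by linarith [chartNormSq_nonneg w]
    have : 0 < r ^ 2 / (1 + chartNormSq w) := by positivity
    simp only [Set.mem_ofPred_eq, chartNormSq_darboux]
    linarith
  · intro hz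
    have hq : 0 < r ^ 2 - chartNormSq z := by
      have : chartNormSq z < r ^ 2 := hz
      linarith
    have hsq := Real.sqrt_pos.mpr hq
    -- The radial factor at the preimage is forced: its square is r² - |z|² and its sign is that of
    -- r.
    set ρ : ℝ := r * √(r ^ 2 - chartNormSq z) / |r| with hρdef
    have habs : |r| ≠ 0 := abs_ne_zero.mpr hr
    have hρ : ρ ≠ 0 := by positivity
    refine ⟨ρ⁻¹ • z, ?_⟩
    have hρ2 : ρ ^ 2 = r ^ 2 - chartNormSq z := by
      rw [hρdef, div_pow, mul_pow, Real.sq_sqrt hq.le, sq_abs]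
      field_simp
    have hfac : radialFactor r (ρ⁻¹ • z) = ρ := by
      have hS : 1 + chartNormSq (ρ⁻¹ • z) = (|r| / √(r ^ 2 - chartNormSq z)) ^ 2 := by
        rw [chartNormSq_smul, inv_pow, hρ2, div_pow, Real.sq_sqrt hq.le, sq_abs]
        field_simp; ring
      rw [radialFactor, hS, Real.sqrt_sq (by positivity), hρdef]
      field_simp
    rw [darboux, hfac, smul_inv_smul₀ hρ]

/-! ### Laplace and Fourier integrals -/

section Analysis

open MeasureTheory Filter Topology Complex

/-- Compares all poles with the one scale √(1+x²), so that two of them are dominated by 1/(1+x²). -/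
theorem norm_I_mul_add_ge (a x : ℝ) : min 1 a * √(1 + x ^ 2) ≤ ‖I * x + a‖ := by
  rcases le_or_gt a 0 with ha | ha
  · exact (mul_nonpos_of_nonpos_of_nonneg ((min_le_right _ _).trans ha) (Real.sqrt_nonneg _)).trans
      (norm_nonneg _)
  have hm : 0 ≤ min 1 a := le_min zero_le_one ha.le
  have hn : ‖I * x + a‖ = √(x ^ 2 + a ^ 2) := by
    rw [Complex.norm_def, normSq_apply]
    congr 1
    simp
    ring
  rw [hn]
  refine Real.le_sqrt_of_sq_le ?_
  rw [mul_pow, Real.sq_sqrt (by positivity)]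
  have h1 : min 1 a ^ 2 ≤ 1 := pow_le_one₀ hm (min_le_left _ _)
  have h2 : min 1 a ^ 2 ≤ a ^ 2 := pow_le_pow_left₀ hm (min_le_right _ _) 2
  nlinarith [mul_le_mul_of_nonneg_right h1 (sq_nonneg x)]

theorem I_mul_add_ne_zero {a : ℝ} (ha : 0 < a) (x : ℝ) : I * x + a ≠ 0 := fun h => by
  simpa [ha.ne'] using congrArg Complex.re h

theorem norm_inv_I_mul_add_le {a : ℝ} (ha : 0 < a) (x : ℝ) :
    ‖(I * x + a)⁻¹‖ ≤ (min 1 a)⁻¹ * (√(1 + x ^ 2))⁻¹ := by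
  have hm : 0 < min 1 a := lt_min one_pos ha
  rw [norm_inv, ← mul_inv]
  exact inv_anti₀ (by positivity) (norm_I_mul_add_ge a x)

theorem norm_inv_I_mul_add_le_const {a : ℝ} (ha : 0 < a) (x : ℝ) :
    ‖(I * x + a)⁻¹‖ ≤ (min 1 a)⁻¹ := by
  have hm : 0 < min 1 a := lt_min one_pos ha
  refine (norm_inv_I_mul_add_le ha x).trans (mul_le_of_le_one_right (by positivity) ?_)
  exact inv_le_one_of_one_le₀ (Real.one_le_sqrt.mpr (by nlinarith [sq_nonneg x]))

theorem continuous_inv_I_mul_add {a : ℝ} (ha : 0 < a) :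
    Continuous fun x : ℝ => (I * x + a)⁻¹ :=
  Continuous.inv₀ (by fun_prop) (I_mul_add_ne_zero ha)

theorem integrable_inv_mul_inv {a b : ℝ} (ha : 0 < a) (hb : 0 < b) :
    Integrable fun x : ℝ => (I * x + a)⁻¹ * (I * x + b)⁻¹ := by
  have hma : 0 < min 1 a := lt_min one_pos ha
  refine (integrable_inv_one_add_sq.const_mul ((min 1 a)⁻¹ * (min 1 b)⁻¹)).mono'
    ((continuous_inv_I_mul_add ha).mul (continuous_inv_I_mul_add hb)).aestronglyMeasurable
    (Eventually.of_forall fun x => ?_)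
  rw [norm_mul]
  refine (mul_le_mul (norm_inv_I_mul_add_le ha x) (norm_inv_I_mul_add_le hb x) (norm_nonneg _)
    (by positivity)).trans_eq ?_
  rw [mul_mul_mul_comm, ← mul_inv √_, Real.mul_self_sqrt (by positivity)]

theorem integrable_inv_mul_inv_mul_prod {ι : Type*} (t : Finset ι) {c : ι → ℝ} {a b : ℝ}
    (ha : 0 < a) (hb : 0 < b) (hc : ∀ i, 0 < c i) (s : ℝ) :
    Integrable fun x : ℝ => (I * x + a)⁻¹ * (I * x + b)⁻¹ *
      (cexp (I * x * s) * ∏ i ∈ t, (I * x + c i)⁻¹) := by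
  refine (integrable_inv_mul_inv ha hb).mul_bdd (c := ∏ i ∈ t, (min 1 (c i))⁻¹) ?_ ?_
  · exact ((by fun_prop : Continuous fun x : ℝ => cexp (I * x * s)).mul
      (continuous_finsetProd _ fun i _ =>
        continuous_inv_I_mul_add (hc i))).aestronglyMeasurable
  · refine Eventually.of_forall fun x => ?_
    have : ‖cexp (I * x * s)‖ = 1 := by rw [norm_exp]; simp
    rw [norm_mul, this, one_mul, norm_prod]
    exact Finset.prod_le_prod (fun _ _ => norm_nonneg _)
      fun i _ => norm_inv_I_mul_add_le_const (hc i) x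

theorem tendsto_inv_I_mul_add {l : Filter ℝ} (hl : Tendsto (fun x : ℝ => |x|) l atTop) {a : ℝ} :
    Tendsto (fun x : ℝ => (I * x + a)⁻¹) l (𝓝 0) := by
  refine tendsto_inv₀_cobounded.comp (tendsto_norm_atTop_iff_cobounded.mp ?_)
  refine tendsto_atTop_mono (fun x => ?_) hl
  simpa using Complex.abs_im_le_norm (I * x + a)

/-- Logarithmic differentiation; the sum over k of extra poles is what the sum over the charts will
produce. -/
theorem hasDerivAt_exp_mul_prod_inv {ι : Type*} [Fintype ι] {a : ι → ℝ}
    (ha : ∀ i, 0 < a i) (s x : ℝ) :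
    HasDerivAt (fun x : ℝ => cexp (I * x * s) * ∏ i, (I * x + a i)⁻¹)
      (I * (s * (cexp (I * x * s) * ∏ i, (I * x + a i)⁻¹) -
        ∑ k, cexp (I * x * s) * (∏ i, (I * x + a i)⁻¹) * (I * x + a k)⁻¹)) x := by
  classical
  have hid : HasDerivAt (fun x : ℝ => I * (x : ℂ)) I x := by
    simpa using (hasDerivAt_id x).ofReal_comp.const_mul I
  have h1 := (hid.mul_const (s : ℂ)).cexp
  have h2 := HasDerivAt.fun_finsetProd (u := Finset.univ)
    (fun i _ => ((hid.add_const (a i : ℂ)).fun_inv (I_mul_add_ne_zero (ha i) x)))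
  refine (h1.mul h2).congr_deriv ?_
  have h3 : ∀ k, (∏ j ∈ Finset.univ.erase k, (I * x + a j)⁻¹) • (-I / (I * x + a k) ^ 2) =
      -I * ((∏ i, (I * x + a i)⁻¹) * (I * x + a k)⁻¹) := fun k => by
    rw [← Finset.mul_prod_erase _ _ (Finset.mem_univ k), smul_eq_mul]
    have := I_mul_add_ne_zero (ha k) x
    field_simp
  rw [Finset.sum_congr rfl fun k _ => h3 k, ← Finset.mul_sum, mul_sub]
  simp only [mul_assoc, ← Finset.mul_sum]
  ring

theorem integrable_exp_mul_prod_inv_mul_inv {ι : Type*} [Fintype ι] {a : ι → ℝ}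
    (ha : ∀ i, 0 < a i) (s : ℝ) (k : ι) :
    Integrable fun x : ℝ => cexp (I * x * s) * (∏ i, (I * x + a i)⁻¹) * (I * x + a k)⁻¹ := by
  classical
  refine (integrable_inv_mul_inv_mul_prod (Finset.univ.erase k) (ha k) (ha k) ha s).congr
    (Eventually.of_forall fun x => ?_)
  simp only
  rw [← Finset.mul_prod_erase _ _ (Finset.mem_univ k)]
  ring

/-- Integration by parts for the improper Fourier integral of a product of simple poles. -/
theorem tendsto_intervalIntegral_exp_mul_prod_inv {ι : Type*} [Fintype ι] [Nonempty ι]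
    {a : ι → ℝ} (ha : ∀ i, 0 < a i) {s : ℝ} (hs : s ≠ 0) :
    Tendsto (fun T : ℝ × ℝ => ∫ x in T.1..T.2, cexp (I * x * s) * ∏ i, (I * x + a i)⁻¹)
      (atBot ×ˢ atTop)
      (𝓝 ((s : ℂ)⁻¹ * ∑ k, ∫ x : ℝ,
        cexp (I * x * s) * (∏ i, (I * x + a i)⁻¹) * (I * x + a k)⁻¹)) := by
  set g : ℝ → ℂ := fun x => cexp (I * x * s) * ∏ i, (I * x + a i)⁻¹ with hg
  set K : ℝ → ℂ := fun x => ∑ k, cexp (I * x * s) * (∏ i, (I * x + a i)⁻¹) * (I * x + a k)⁻¹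
    with hK
  have hgc : Continuous g := (by fun_prop : Continuous fun x : ℝ => cexp (I * x * s)).mul
    (continuous_finsetProd _ fun i _ => continuous_inv_I_mul_add (ha i))
  have hKc : Continuous K := continuous_finsetSum _ fun k _ =>
    hgc.mul (continuous_inv_I_mul_add (ha k))
  have hKi : Integrable K := integrable_finsetSum _ fun k _ =>
    integrable_exp_mul_prod_inv_mul_inv ha s k
  have hparts : ∀ T : ℝ × ℝ, ∫ x in T.1..T.2, g x =
      (s : ℂ)⁻¹ * ((∫ x in T.1..T.2, K x) + -I * (g T.2 - g T.1)) := fun T => by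
    have h := intervalIntegral.integral_eq_sub_of_hasDerivAt (a := T.1) (b := T.2)
      (fun x _ => hasDerivAt_exp_mul_prod_inv ha s x)
      (Continuous.intervalIntegrable (by
        exact continuous_const.mul ((continuous_const.mul hgc).sub hKc)) _ _)
    change ∫ x in T.1..T.2, I * (s * g x - K x) = g T.2 - g T.1 at h
    have hi : IntervalIntegrable (fun x => (s : ℂ) * g x) volume T.1 T.2 :=
      (continuous_const.mul hgc).intervalIntegrable _ _
    rw [← h, intervalIntegral.integral_const_mul,
      intervalIntegral.integral_sub hi (hKc.intervalIntegrable _ _),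
      intervalIntegral.integral_const_mul, ← mul_assoc (-I), neg_mul, I_mul_I]
    have : (s : ℂ) ≠ 0 := ofReal_ne_zero.mpr hs
    field_simp
    ring
  have hg0 : ∀ {l : Filter ℝ}, Tendsto (fun x : ℝ => |x|) l atTop → Tendsto g l (𝓝 0) := by
    intro l hl
    -- The limit is a product of zeros, which is 0 because ι is nonempty.
    have h : Tendsto (fun x : ℝ => ∏ i, (I * x + a i)⁻¹) l (𝓝 0) := by
      simpa using tendsto_finsetProd Finset.univ fun i _ => tendsto_inv_I_mul_add hl (a := a i)
    refine squeeze_zero_norm (fun x => ?_) (tendsto_zero_iff_norm_tendsto_zero.mp h)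
    have : ‖cexp (I * x * s)‖ = 1 := by rw [norm_exp]; simp
    rw [hg, norm_mul, this, one_mul]
  have hlim := ((intervalIntegral_tendsto_integral hKi (tendsto_fst (f := atBot) (g := atTop))
    (tendsto_snd (f := atBot) (g := atTop))).add
      ((((hg0 tendsto_abs_atTop_atTop).comp (tendsto_snd (f := atBot))).sub
      ((hg0 tendsto_abs_atBot_atTop).comp (tendsto_fst (g := atTop)))).const_mul (-I))).const_mul
      (s : ℂ)⁻¹
  rw [sub_zero, mul_zero, add_zero, hK, integral_finsetSum _ fun k _ =>
    integrable_exp_mul_prod_inv_mul_inv ha s k] at hlim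
  exact hlim.congr fun T => (hparts T).symm

/-! ### Fourier inversion for a double pole -/

theorem hasDerivAt_laplace_primitive {b : ℂ} (hb : b ≠ 0) (t : ℝ) :
    HasDerivAt (fun t : ℝ => -(t / b + 1 / b ^ 2) * cexp (-b * t)) (t * cexp (-b * t)) t := by
  have hid : HasDerivAt (fun t : ℝ => (t : ℂ)) 1 t := (hasDerivAt_id t).ofReal_comp
  refine (((hid.div_const b).add_const (1 / b ^ 2)).neg.mul
    (hid.const_mul (-b)).cexp).congr_deriv ?_
  simp only [Pi.neg_apply]
  field_simp
  ring

theorem integrable_max_mul_exp {a : ℝ} (ha : 0 < a) :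
    Integrable fun t : ℝ => ((max t 0 * Real.exp (-a * t) : ℝ) : ℂ) := by
  have h : IntegrableOn (fun t : ℝ => t * Real.exp (-a * t)) (Set.Ioi 0) := by
    simpa using integrableOn_rpow_mul_exp_neg_mul_rpow (s := 1) (p := 1) (b := a)
      (by norm_num) one_pos ha
  suffices h' : Integrable fun t : ℝ => max t 0 * Real.exp (-a * t) from h'.ofReal
  rw [← integrable_indicator_iff measurableSet_Ioi] at h
  refine h.congr (Eventually.of_forall fun t => ?_)
  rcases le_or_gt t 0 with ht | ht
  · simp [ht]
  · simp [ht, ht.le]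

theorem laplace_max {a : ℝ} (ha : 0 < a) (y : ℝ) :
    ∫ t : ℝ, cexp (-(I * y) * t) * ((max t 0 * Real.exp (-a * t) : ℝ) : ℂ) =
      ((I * y + a)⁻¹) ^ 2 := by
  set b : ℂ := I * y + a with hbdef
  have hb : b ≠ 0 := I_mul_add_ne_zero ha y
  have hbre : b.re = a := by simp [hbdef]
  have heq : (fun t : ℝ => cexp (-(I * y) * t) * ((max t 0 * Real.exp (-a * t) : ℝ) : ℂ)) =
      (Set.Ioi 0).indicator fun t : ℝ => t * cexp (-b * t) := by
    ext t
    rcases le_or_gt t 0 with ht | ht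
    · simp [ht]
    · simp only [Set.indicator_of_mem (Set.mem_Ioi.mpr ht), max_eq_left ht.le]
      push_cast
      rw [mul_left_comm, ← Complex.exp_add, hbdef]
      congr 2
      ring
  have hint : IntegrableOn (fun t : ℝ => t * cexp (-b * t)) (Set.Ioi 0) := by
    rw [← integrable_indicator_iff measurableSet_Ioi, ← heq]
    refine (integrable_max_mul_exp ha).bdd_mul (c := 1)
      (by fun_prop : Continuous fun t : ℝ => cexp (-(I * y) * t)).aestronglyMeasurable
      (Eventually.of_forall fun t => ?_)
    rw [norm_exp]
    simp
  have hpow : ∀ n : ℕ, Tendsto (fun t : ℝ => (t : ℂ) ^ n * cexp (-b * t)) atTop (𝓝 0) := fun n => by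
    refine tendsto_zero_iff_norm_tendsto_zero.mpr
      ((tendsto_rpow_mul_exp_neg_mul_atTop_nhds_zero n a ha).congr' ?_)
    filter_upwards [eventually_gt_atTop 0] with t ht
    simp [norm_exp, hbre, abs_of_pos ht]
  have hlim : Tendsto (fun t : ℝ => -(t / b + 1 / b ^ 2) * cexp (-b * t)) atTop (𝓝 0) := by
    have h := ((hpow 1).const_mul (-(1 / b))).add ((hpow 0).const_mul (-(1 / b ^ 2)))
    rw [mul_zero, mul_zero, add_zero] at h
    exact h.congr fun t => by ring
  rw [heq, integral_indicator measurableSet_Ioi,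
    integral_Ioi_of_hasDerivAt_of_tendsto' (fun t _ => hasDerivAt_laplace_primitive hb t)
    hint hlim]
  simp

/-- Fourier inversion for `t ↦ t₊ e^{-at}`. -/
theorem integral_exp_mul_inv_sq {a : ℝ} (ha : 0 < a) (u : ℝ) :
    ∫ x : ℝ, cexp (I * x * u) * ((I * x + a)⁻¹) ^ 2 =
      2 * Real.pi * ((max u 0 * Real.exp (-a * u) : ℝ) : ℂ) := by
  set f : ℝ → ℂ := fun t => ((max t 0 * Real.exp (-a * t) : ℝ) : ℂ) with hf
  -- The Fourier kernel is e^{-2πitw}, so the pole variable is 2πw; `hcv` below undoes this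
  -- rescaling.
  have hF : FourierTransform.fourier f = fun w : ℝ => ((I * (2 * Real.pi * w : ℝ) + a)⁻¹) ^ 2 := by
    ext w
    rw [Real.fourier_real_eq_integral_exp_smul, ← laplace_max ha]
    refine integral_congr_ae (Eventually.of_forall fun t => ?_)
    simp only [smul_eq_mul, hf]
    congr 2
    push_cast
    ring
  have hFi : Integrable (FourierTransform.fourier f) := by
    rw [hF]
    have := (integrable_inv_mul_inv ha ha).comp_mul_left' (R := 2 * Real.pi)
      (by positivity)
    simpa only [sq] using this
  -- Pointwise inversion needs a continuous f with integrable transform. The factor t₊, which comes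
  -- from the partition of unity, supplies both: no jump at 0, and a double pole.
  have hinv := congrFun (Continuous.fourierInv_fourier_eq (f := f) (by fun_prop)
    (integrable_max_mul_exp ha) hFi) u
  rw [Real.fourierInv_eq', hF] at hinv
  have hcv := Measure.integral_comp_mul_left
    (fun x : ℝ => cexp (I * x * u) * ((I * x + a)⁻¹) ^ 2) (2 * Real.pi)
  have hfu : (2 * Real.pi : ℂ)⁻¹ * ∫ x : ℝ, cexp (I * x * u) * ((I * x + a)⁻¹) ^ 2 = f u := by
    rw [← hinv]
    rw [abs_of_pos (by positivity), real_smul] at hcv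
    push_cast at hcv
    rw [← hcv]
    refine integral_congr_ae (Eventually.of_forall fun t => ?_)
    simp only [smul_eq_mul]
    push_cast
    congr 2
    simp
    ring
  have hpi : (2 * Real.pi : ℂ) ≠ 0 := by simp [Real.pi_ne_zero]
  rw [← (inv_mul_eq_iff_eq_mul₀ hpi).mp hfu]


end Analysis

open MeasureTheory Filter Topology

/-! ### Gaussian integrals and the exchange of integrals -/

section GaussianFubini

open Complex

variable {ι : Type*} [Fintype ι]

theorem integral_cexp_neg_half_mul_normSq {b : ℂ} (hb : 0 < b.re) :
    ∫ z : ℂ, cexp (-b * (normSq z / 2 : ℝ)) = 2 * Real.pi * b⁻¹ := by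
  have h := GaussianFourier.integral_cexp_neg_mul_sq_norm (V := ℂ) (b := b / 2) (by simpa using hb)
  have hb0 : b ≠ 0 := fun h0 => by simp [h0] at hb
  rw [Complex.finrank_real_complex, Nat.cast_two, div_self two_ne_zero, cpow_one] at h
  rw [show 2 * (Real.pi : ℂ) * b⁻¹ = Real.pi / (b / 2) by field_simp, ← h]
  refine integral_congr_ae (Eventually.of_forall fun z => ?_)
  simp only [normSq_eq_norm_sq]
  push_cast
  congr 1
  ring

theorem integrable_exp_neg_half_mul_normSq {c : ℝ} (hc : 0 < c) :
    Integrable fun z : ℂ => cexp (-c * (normSq z / 2 : ℝ)) := by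
  -- A non-integrable function has integral 0 by convention, but the Gaussian integral is nonzero.
  by_contra h
  have h' := integral_undef h
  rw [integral_cexp_neg_half_mul_normSq (by simpa using hc)] at h'
  simp [Real.pi_ne_zero, hc.ne'] at h'

/-- The oscillating factor has modulus 1; the Gaussians control z and the double pole controls x. -/
theorem integrable_fourier_gaussian {c : ι → ℝ} (hc : ∀ i, 0 < c i) {a : ℝ} (ha : 0 < a) (s : ℝ) :
    Integrable (Function.uncurry fun (z : ι → ℂ) (x : ℝ) =>
      (∏ i, cexp (-c i * (normSq (z i) / 2 : ℝ))) *
        (cexp (I * x * (s - ∑ i, normSq (z i) / 2 : ℝ)) * ((I * x + a)⁻¹) ^ 2))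
      (volume.prod volume) := by
  have h1 : Integrable fun z : ι → ℂ => ∏ i, cexp (-c i * (normSq (z i) / 2 : ℝ)) :=
    Integrable.fintype_prod (f := fun i z => cexp (-c i * (normSq z / 2 : ℝ)))
      fun i => integrable_exp_neg_half_mul_normSq (hc i)
  have hn : ∀ i, Continuous fun p : (ι → ℂ) × ℝ => normSq (p.1 i) := fun i =>
    continuous_normSq.comp ((continuous_apply i).comp continuous_fst)
  have h2 := (h1.mul_prod (integrable_inv_mul_inv ha ha)).bdd_mul (c := 1)
    (f := fun p : (ι → ℂ) × ℝ => cexp (I * p.2 * (s - ∑ i, normSq (p.1 i) / 2 : ℝ)))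
    (Continuous.aestronglyMeasurable (by fun_prop)) (Eventually.of_forall fun p => by
      rw [norm_exp]; simp)
  refine h2.congr (Eventually.of_forall fun p => ?_)
  simp only [Function.uncurry]
  ring

/-- The Fourier representation of the integral over a ball of a Gaussian times
`u₊ e^{-au}`, `u = s - |z|² / 2`. -/
theorem integral_max_mul_exp_mul_gaussian {c : ι → ℝ} (hc : ∀ i, 0 < c i) {a : ℝ} (ha : 0 < a)
    (s : ℝ) :
    2 * Real.pi * ∫ z : ι → ℂ, (((max (s - ∑ i, normSq (z i) / 2) 0 *
        Real.exp (-a * (s - ∑ i, normSq (z i) / 2))) *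
        ∏ i, Real.exp (-c i * (normSq (z i) / 2)) : ℝ) : ℂ) =
      (2 * Real.pi) ^ Fintype.card ι * ∫ x : ℝ,
        cexp (I * x * s) * ((I * x + a)⁻¹) ^ 2 * ∏ i, (I * x + c i)⁻¹ := by
  rw [← integral_const_mul]
  have h1 : ∀ z : ι → ℂ, 2 * Real.pi * (((max (s - ∑ i, normSq (z i) / 2) 0 *
        Real.exp (-a * (s - ∑ i, normSq (z i) / 2))) *
        ∏ i, Real.exp (-c i * (normSq (z i) / 2)) : ℝ) : ℂ) =
      ∫ x : ℝ, (∏ i, cexp (-c i * (normSq (z i) / 2 : ℝ))) *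
        (cexp (I * x * (s - ∑ i, normSq (z i) / 2 : ℝ)) * ((I * x + a)⁻¹) ^ 2) := fun z => by
    rw [integral_const_mul, integral_exp_mul_inv_sq ha, ofReal_mul (_ * _), ofReal_prod]
    simp only [ofReal_exp, ofReal_mul (-_), ofReal_neg]
    ring
  simp only [h1]
  rw [integral_integral_swap (integrable_fourier_gaussian hc ha s), ← integral_const_mul]
  refine integral_congr_ae (Eventually.of_forall fun x => ?_)
  -- For fixed x, the phase e^{-ix|z_i|²/2} joins the i-th Gaussian, whose parameter becomes ix +
  -- c_i, and the z-integral factorizes.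
  have h2 : ∀ z : ι → ℂ, (∏ i, cexp (-c i * (normSq (z i) / 2 : ℝ))) *
        (cexp (I * x * (s - ∑ i, normSq (z i) / 2 : ℝ)) * ((I * x + a)⁻¹) ^ 2) =
      (cexp (I * x * s) * ((I * x + a)⁻¹) ^ 2) *
        ∏ i, cexp (-(I * x + c i) * (normSq (z i) / 2 : ℝ)) := fun z => by
    have : cexp (I * x * (s - ∑ i, normSq (z i) / 2 : ℝ)) =
        cexp (I * x * s) * ∏ i, cexp (-(I * x) * (normSq (z i) / 2 : ℝ)) := by
      rw [← Complex.exp_sum, ← Complex.exp_add, ← Finset.mul_sum]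
      congr 1
      push_cast
      ring
    have h3 : ∀ i, cexp (-(I * x + c i) * (normSq (z i) / 2 : ℝ)) =
        cexp (-(I * x) * (normSq (z i) / 2 : ℝ)) * cexp (-c i * (normSq (z i) / 2 : ℝ)) :=
      fun i => by
        rw [← Complex.exp_add]
        congr 1
        ring
    rw [this, Finset.prod_congr rfl fun i _ => h3 i, Finset.prod_mul_distrib]
    ring
  simp only [h2]
  rw [integral_const_mul, integral_fintype_prod_volume_eq_prod
    (fun i z => cexp (-(I * x + c i) * (normSq z / 2 : ℝ)))]
  rw [Finset.prod_congr rfl fun i _ =>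
    integral_cexp_neg_half_mul_normSq (b := I * x + c i) (by simpa using hc i),
    Finset.prod_mul_distrib, Finset.prod_const, Finset.card_univ]
  ring

end GaussianFubini

/-! ### The chart integrals -/

/-- The weight `σ_j + ħ m` of the coordinate `φ^j_m`. -/
def weight (ħ : ℝ) (σ : Fin (ℓ + 1) → ℝ) (i : Idx ℓ d) : ℝ := σ i.1 + ħ * i.2

/-- The integrand of the equivariant volume in Darboux coordinates. -/
def darbouxDensity (r ħ : ℝ) (σ : Fin (ℓ + 1) → ℝ) (k : Idx ℓ d) (z : ChartSpace k) : ℝ :=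
  (r ^ 2 / 2)⁻¹ * ((max (r ^ 2 / 2 - ∑ i, Complex.normSq (z i) / 2) 0 *
    Real.exp (-weight ħ σ k * (r ^ 2 / 2 - ∑ i, Complex.normSq (z i) / 2))) *
    ∏ i : ChartIdx k, Real.exp (-weight ħ σ i.1 * (Complex.normSq (z i) / 2)))

theorem chartWeight_toQuasimap (k : Idx ℓ d) (φ : CoeffSpace ℓ d) (hφ : φ ≠ 0) :
    chartWeight k (toQuasimap φ hφ) = Complex.normSq (φ k) / normSqSum φ := by
  obtain ⟨a, ha⟩ := Projectivization.exists_smul_eq_mk_rep ℂ ((coeffs ℓ d).symm φ)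
    (by simpa using hφ)
  have hrep : coeffs ℓ d (toQuasimap φ hφ).rep = (a : ℂ) • φ := by
    rw [toQuasimap, ← ha, Units.smul_def, map_smul, LinearEquiv.apply_symm_apply]
  have hpos : Complex.normSq (a : ℂ) ≠ 0 := (Complex.normSq_pos.mpr a.ne_zero).ne'
  rw [chartWeight, hrep, normSqSum_smul, Pi.smul_apply, smul_eq_mul, Complex.normSq_mul,
    mul_div_mul_left _ _ hpos]

theorem levelSection_self (r : ℝ) (k : Idx ℓ d) (w : ChartSpace k) :
    levelSection r k w k = radialFactor r w := by
  simp [levelSection_eq, homog_self]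

theorem levelSection_coe (r : ℝ) (k : Idx ℓ d) (w : ChartSpace k) (i : ChartIdx k) :
    levelSection r k w i = darboux r w i := by
  simp [levelSection_eq, homog_coe, darboux]

theorem redMoment_chartInv {r : ℝ} (hr : r ≠ 0) (ħ : ℝ) (σ : Fin (ℓ + 1) → ℝ) (k : Idx ℓ d)
    (w : ChartSpace k) :
    redMoment r ħ σ (chartInv k w) = -weight ħ σ k * (r ^ 2 / (1 + chartNormSq w) / 2) +
      ∑ i : ChartIdx k, -weight ħ σ i.1 * (Complex.normSq (darboux r w i) / 2) := by
  have hS : 0 < 1 + chartNormSq w := by linarith [chartNormSq_nonneg w]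
  have hne : levelSection r k w ≠ 0 := fun h => by
    have h0 := congrFun h k
    rw [levelSection_self] at h0
    exact div_ne_zero hr (Real.sqrt_pos.mpr hS).ne' (Complex.ofReal_eq_zero.mp h0)
  rw [← toQuasimap_levelSection k w hne, redMoment_toQuasimap _ _ _ _ _ (levelSection_mem r k w),
    equivMoment_eq, sum_eq_add_sum_chartIdx k, levelSection_self, Complex.normSq_ofReal, ← sq,
    radialFactor_sq, mul_add, Finset.mul_sum]
  congr 1
  · rw [weight]; ring
  · refine Finset.sum_congr rfl fun i _ => ?_
    rw [levelSection_coe, weight]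
    ring

/-- The partition function 1/(1+|w|²) equals u/(r²/2) with u = r²/2 - |z|²/2 > 0; this is the source
of the factor `max` and of the prefactor. -/
theorem volumeIntegrand_eq {r : ℝ} (hr : r ≠ 0) (ħ : ℝ) (σ : Fin (ℓ + 1) → ℝ) (k : Idx ℓ d)
    (w : ChartSpace k) :
    volumeIntegrand r ħ σ k w = |(darbouxDeriv r w).det| • darbouxDensity r ħ σ k (darboux r w) := by
  have hS : 0 < 1 + chartNormSq w := by linarith [chartNormSq_nonneg w]
  have hu : r ^ 2 / 2 - ∑ i, Complex.normSq (darboux r w i) / 2 =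
      r ^ 2 / (1 + chartNormSq w) / 2 := by
    rw [← Finset.sum_div]
    change r ^ 2 / 2 - chartNormSq (darboux r w) / 2 = _
    rw [chartNormSq_darboux]
    ring
  have hcw : chartWeight k (chartInv k w) = 1 / (1 + chartNormSq w) := by
    rw [chartInv, chartWeight_toQuasimap, homog_self, normSqSum_homog, map_one]
  rw [volumeIntegrand, expTopCoeff, hcw, redMoment_chartInv hr, dividedWedgePow_reducedForm,
    abs_of_nonneg (det_darbouxDeriv_nonneg hr w), darbouxDensity, hu, max_eq_left (by positivity),
    Real.exp_add, Real.exp_sum, smul_eq_mul]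
  field_simp

theorem continuous_darbouxDensity (r ħ : ℝ) (σ : Fin (ℓ + 1) → ℝ) (k : Idx ℓ d) :
    Continuous (darbouxDensity r ħ σ k) := by
  have hn : ∀ i : ChartIdx k, Continuous fun z : ChartSpace k => Complex.normSq (z i) := fun i =>
    Complex.continuous_normSq.comp (continuous_apply i)
  unfold darbouxDensity
  fun_prop

theorem darbouxDensity_eq_zero (r ħ : ℝ) (σ : Fin (ℓ + 1) → ℝ) (k : Idx ℓ d) {z : ChartSpace k}
    (hz : r ^ 2 ≤ chartNormSq z) : darbouxDensity r ħ σ k z = 0 := by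
  have : r ^ 2 / 2 - ∑ i, Complex.normSq (z i) / 2 ≤ 0 := by
    rw [← Finset.sum_div]
    change r ^ 2 / 2 - chartNormSq z / 2 ≤ 0
    linarith
  rw [darbouxDensity, max_eq_right this]
  simp

/-- The factor u₊ vanishes at the boundary of the ball, so the density is continuous with compact
support. -/
theorem integrable_darbouxDensity (r ħ : ℝ) (σ : Fin (ℓ + 1) → ℝ) (k : Idx ℓ d) :
    Integrable (darbouxDensity r ħ σ k) := by
  refine (continuous_darbouxDensity r ħ σ k).integrable_of_hasCompactSupport
    (HasCompactSupport.of_support_subset_isCompact (isCompact_closedBall 0 |r|) fun z hz => ?_)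
  have hlt : chartNormSq z < r ^ 2 := by
    by_contra! h
    exact hz (darbouxDensity_eq_zero r ħ σ k h)
  rw [mem_closedBall_zero_iff, pi_norm_le_iff_of_nonneg (abs_nonneg r)]
  intro i
  have hi : Complex.normSq (z i) ≤ chartNormSq z :=
    Finset.single_le_sum (f := fun i => Complex.normSq (z i))
      (fun _ _ => Complex.normSq_nonneg _) (Finset.mem_univ i)
  rw [Complex.normSq_eq_norm_sq] at hi
  exact abs_le_of_sq_le_sq' (by rw [sq_abs]; linarith) (abs_nonneg r) |>.2

theorem integrable_volumeIntegrand {r : ℝ} (hr : r ≠ 0) (ħ : ℝ) (σ : Fin (ℓ + 1) → ℝ)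
    (k : Idx ℓ d) : Integrable (volumeIntegrand r ħ σ k) := by
  have h := (integrableOn_image_iff_integrableOn_abs_det_fderiv_smul volume MeasurableSet.univ
    (fun w _ => (hasFDerivAt_darboux r w).hasFDerivWithinAt) (darboux_injective hr).injOn
    (darbouxDensity r ħ σ k)).mp (integrable_darbouxDensity r ħ σ k).integrableOn
  rw [integrableOn_univ] at h
  exact h.congr (Eventually.of_forall fun w => (volumeIntegrand_eq hr ħ σ k w).symm)

theorem integral_volumeIntegrand {r : ℝ} (hr : r ≠ 0) (ħ : ℝ) (σ : Fin (ℓ + 1) → ℝ)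
    (k : Idx ℓ d) :
    ∫ w, volumeIntegrand r ħ σ k w = ∫ z, darbouxDensity r ħ σ k z := by
  have h := integral_image_eq_integral_abs_det_fderiv_smul volume MeasurableSet.univ
    (fun w _ => (hasFDerivAt_darboux r w).hasFDerivWithinAt) (darboux_injective hr).injOn
    (darbouxDensity r ħ σ k)
  rw [Set.image_univ, range_darboux hr, setIntegral_univ] at h
  rw [← setIntegral_eq_integral_of_forall_compl_eq_zero (s := {z | chartNormSq z < r ^ 2})
    fun z hz => darbouxDensity_eq_zero r ħ σ k (not_lt.mp hz), h]
  exact integral_congr_ae (Eventually.of_forall fun w => volumeIntegrand_eq hr ħ σ k w)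

/-! ### The contour integral -/

/-- Since u + ∑ |z_i|²/2 = r²/2, raising all weights by ε multiplies the exponentials by the
constant e^{-εr²/2}. -/
theorem darbouxDensity_eq_shift (r ħ : ℝ) (σ : Fin (ℓ + 1) → ℝ) (ε : ℝ) (k : Idx ℓ d)
    (z : ChartSpace k) :
    darbouxDensity r ħ σ k z = (r ^ 2 / 2)⁻¹ * Real.exp (ε * (r ^ 2 / 2)) *
      ((max (r ^ 2 / 2 - ∑ i, Complex.normSq (z i) / 2) 0 *
        Real.exp (-(ε + weight ħ σ k) * (r ^ 2 / 2 - ∑ i, Complex.normSq (z i) / 2))) *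
        ∏ i : ChartIdx k, Real.exp (-(ε + weight ħ σ i.1) * (Complex.normSq (z i) / 2))) := by
  have h : (∏ i : ChartIdx k, Real.exp (-(ε + weight ħ σ i.1) * (Complex.normSq (z i) / 2)))
      = Real.exp (-ε * ∑ i, Complex.normSq (z i) / 2) *
        ∏ i : ChartIdx k, Real.exp (-weight ħ σ i.1 * (Complex.normSq (z i) / 2)) := by
    rw [Finset.mul_sum, Real.exp_sum, ← Finset.prod_mul_distrib]
    refine Finset.prod_congr rfl fun i _ => ?_
    rw [← Real.exp_add]
    ring_nf
  have h2 : Real.exp (-weight ħ σ k * (r ^ 2 / 2 - ∑ i, Complex.normSq (z i) / 2)) =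
      Real.exp (ε * (r ^ 2 / 2)) *
      Real.exp (-(ε + weight ħ σ k) * (r ^ 2 / 2 - ∑ i, Complex.normSq (z i) / 2)) *
      Real.exp (-ε * ∑ i, Complex.normSq (z i) / 2) := by
    rw [← Real.exp_add, ← Real.exp_add]
    ring_nf
  rw [h, darbouxDensity, h2]
  ring

theorem contourIntegrand_sub_mul_I (r ħ : ℝ) (σ : Fin (ℓ + 1) → ℝ) (ε x : ℝ) :
    contourIntegrand d r ħ σ (x - ε * Complex.I) = Real.exp (ε * (r ^ 2 / 2)) *
      (Complex.exp (Complex.I * x * (r ^ 2 / 2 : ℝ)) *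
        ∏ i : Idx ℓ d, (Complex.I * x + (ε + weight ħ σ i : ℝ))⁻¹) := by
  rw [contourIntegrand, Fintype.prod_prod_type, div_eq_mul_inv, ← Finset.prod_inv_distrib,
    ← mul_assoc, Complex.ofReal_exp, ← Complex.exp_add]
  congr 1
  · congr 1
    push_cast
    linear_combination (-(ε : ℂ) * r ^ 2 / 2) * Complex.I_mul_I
  · refine Finset.prod_congr rfl fun j _ => ?_
    rw [Finset.prod_range, ← Finset.prod_inv_distrib]
    refine Finset.prod_congr rfl fun m _ => ?_
    congr 1
    simp only [weight]
    push_cast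
    linear_combination (-(ε : ℂ)) * Complex.I_mul_I

theorem integral_darbouxDensity {r : ℝ} {ħ : ℝ} {σ : Fin (ℓ + 1) → ℝ} {ε : ℝ}
    (hε : ∀ i : Idx ℓ d, 0 < ε + weight ħ σ i) (k : Idx ℓ d) :
    ((∫ z, darbouxDensity r ħ σ k z : ℝ) : ℂ) =
      (2 * (Real.pi : ℂ)) ^ (((ℓ + 1) * (d + 1) : ℤ) - 2) * (Real.exp (ε * (r ^ 2 / 2)) *
        (((r ^ 2 / 2 : ℝ) : ℂ)⁻¹ * ∫ x : ℝ, Complex.exp (Complex.I * x * (r ^ 2 / 2 : ℝ)) *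
          (∏ i : Idx ℓ d, (Complex.I * x + (ε + weight ħ σ i : ℝ))⁻¹) *
          (Complex.I * x + (ε + weight ħ σ k : ℝ))⁻¹)) := by
  have hpi : (2 * Real.pi : ℂ) ≠ 0 := by simp [Real.pi_ne_zero]
  -- N - 1 Gaussians give (2π)^{N-1}, and Fourier inversion removes one more 2π. The exponent N - 2
  -- is an integer, being -1 when N = 1.
  have hcard : (Fintype.card (ChartIdx k) : ℤ) = ((ℓ + 1) * (d + 1) : ℤ) - 2 + 1 := by
    have h : Fintype.card (ChartIdx k) + 1 = (ℓ + 1) * (d + 1) := by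
      rw [Fintype.card_subtype_compl, Fintype.card_subtype_eq, Fintype.card_prod, Fintype.card_fin,
        Fintype.card_fin]
      exact Nat.sub_add_cancel (by nlinarith)
    have h' : (Fintype.card (ChartIdx k) : ℤ) + 1 = (ℓ + 1) * (d + 1) := by exact_mod_cast h
    linarith
  have hG := integral_max_mul_exp_mul_gaussian (c := fun i : ChartIdx k => ε + weight ħ σ i.1)
    (fun i => hε i) (hε k) (r ^ 2 / 2)
  have hpow : (2 * (Real.pi : ℂ)) ^ Fintype.card (ChartIdx k) =
      (2 * (Real.pi : ℂ)) ^ (((ℓ + 1) * (d + 1) : ℤ) - 2) * (2 * Real.pi) := by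
    rw [← zpow_natCast, hcard, zpow_add_one₀ hpi]
  rw [hpow, mul_comm _ (2 * (Real.pi : ℂ)), mul_assoc (2 * (Real.pi : ℂ)) (_ ^ _)] at hG
  have hG' := mul_left_cancel₀ hpi hG
  simp only [darbouxDensity_eq_shift r ħ σ ε]
  rw [integral_const_mul, Complex.ofReal_mul, ← integral_complex_ofReal, hG']
  have hprod : ∀ x : ℝ, ∏ i : Idx ℓ d, (Complex.I * x + (ε + weight ħ σ i : ℝ))⁻¹ =
      (Complex.I * x + (ε + weight ħ σ k : ℝ))⁻¹ *
        ∏ i : ChartIdx k, (Complex.I * x + (ε + weight ħ σ i.1 : ℝ))⁻¹ := fun x =>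
    Fintype.prod_eq_mul_prod_subtype_ne
      (fun i : Idx ℓ d => (Complex.I * x + (ε + weight ħ σ i : ℝ))⁻¹) k
  have hint : ∀ x : ℝ, Complex.exp (Complex.I * x * (r ^ 2 / 2 : ℝ)) *
      ((Complex.I * x + (ε + weight ħ σ k : ℝ))⁻¹) ^ 2 *
        ∏ i : ChartIdx k, (Complex.I * x + (ε + weight ħ σ i.1 : ℝ))⁻¹ =
      Complex.exp (Complex.I * x * (r ^ 2 / 2 : ℝ)) *
          (∏ i : Idx ℓ d, (Complex.I * x + (ε + weight ħ σ i : ℝ))⁻¹) *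
          (Complex.I * x + (ε + weight ħ σ k : ℝ))⁻¹ := fun x => by
    rw [hprod]
    ring
  simp only [hint]
  push_cast
  ring

theorem integrable_contourIntegrand {ħ : ℝ} {σ : Fin (ℓ + 1) → ℝ} {ε : ℝ}
    (hε : ∀ i : Idx ℓ d, 0 < ε + weight ħ σ i) (r : ℝ) (hN : 2 ≤ (ℓ + 1) * (d + 1)) :
    Integrable fun x : ℝ => contourIntegrand d r ħ σ (x - ε * Complex.I) := by
  have : Nontrivial (Idx ℓ d) := by
    rw [← Fintype.one_lt_card_iff_nontrivial]
    rw [Fintype.card_prod, Fintype.card_fin, Fintype.card_fin]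
    exact hN
  obtain ⟨k, k', hk⟩ := exists_pair_ne (Idx ℓ d)
  refine ((integrable_inv_mul_inv_mul_prod ((Finset.univ.erase k).erase k') (hε k) (hε k') hε
    (r ^ 2 / 2)).const_mul (Real.exp (ε * (r ^ 2 / 2)) : ℂ)).congr
    (Eventually.of_forall fun x => ?_)
  simp only [contourIntegrand_sub_mul_I]
  rw [← Finset.mul_prod_erase _ _ (Finset.mem_univ k), ← Finset.mul_prod_erase _ _
    (Finset.mem_erase.mpr ⟨hk.symm, Finset.mem_univ k'⟩)]
  ring

/-- The chart integrals are exactly the summands left by integration by parts at s = r²/2. -/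
theorem tendsto_contourIntegral {r : ℝ} (hr : r ≠ 0) {ħ : ℝ} {σ : Fin (ℓ + 1) → ℝ} {ε : ℝ}
    (hε : ∀ i : Idx ℓ d, 0 < ε + weight ħ σ i) :
    Tendsto (fun T : ℝ × ℝ => (2 * (Real.pi : ℂ)) ^ (((ℓ + 1) * (d + 1) : ℤ) - 2) *
        ∫ x in T.1..T.2, contourIntegrand d r ħ σ (x - ε * Complex.I))
      (atBot ×ˢ atTop) (𝓝 (equivariantVolume ℓ d r ħ σ : ℂ)) := by
  have h := ((tendsto_intervalIntegral_exp_mul_prod_inv hε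
    (by positivity : r ^ 2 / 2 ≠ 0)).const_mul (Real.exp (ε * (r ^ 2 / 2)) : ℂ)).const_mul
    ((2 * (Real.pi : ℂ)) ^ (((ℓ + 1) * (d + 1) : ℤ) - 2))
  simp only [contourIntegrand_sub_mul_I, intervalIntegral.integral_const_mul]
  convert h using 2
  rw [equivariantVolume, Complex.ofReal_sum]
  simp only [integral_volumeIntegrand hr, integral_darbouxDensity hε, Finset.mul_sum]

end Quasimap

end

theorem mainTheorem7 (ℓ d : ℕ) (r : ℝ) (hr : r ≠ 0) (ħ : ℝ) (σ : Fin (ℓ + 1) → ℝ) (ε : ℝ)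
    (hε : ∀ j : Fin (ℓ + 1), ∀ m ∈ Finset.range (d + 1), -(σ j + ħ * m) < ε) :
    (∀ k : Quasimap.Idx ℓ d,
      MeasureTheory.Integrable (Quasimap.volumeIntegrand r ħ σ k)) ∧
    Filter.Tendsto
      (fun T : ℝ × ℝ => (2 * (Real.pi : ℂ)) ^ (((ℓ + 1) * (d + 1) : ℤ) - 2) *
        ∫ x in T.1..T.2, Quasimap.contourIntegrand d r ħ σ (x - ε * Complex.I))
      (Filter.atBot ×ˢ Filter.atTop)
      (nhds (Quasimap.equivariantVolume ℓ d r ħ σ : ℂ)) ∧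
    (2 ≤ (ℓ + 1) * (d + 1) →
      MeasureTheory.Integrable
        (fun x : ℝ => Quasimap.contourIntegrand d r ħ σ (x - ε * Complex.I)) ∧
      (Quasimap.equivariantVolume ℓ d r ħ σ : ℂ) =
        (2 * (Real.pi : ℂ)) ^ (((ℓ + 1) * (d + 1) : ℤ) - 2) *
          ∫ x : ℝ, Quasimap.contourIntegrand d r ħ σ (x - ε * Complex.I)) := by
  have hε' : ∀ i : Quasimap.Idx ℓ d, 0 < ε + Quasimap.weight ħ σ i := fun i => by
    have := hε i.1 i.2 (Finset.mem_range.mpr i.2.isLt)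
    rw [Quasimap.weight]
    linarith
  have hlim := Quasimap.tendsto_contourIntegral hr hε'
  refine ⟨Quasimap.integrable_volumeIntegrand hr ħ σ, hlim, fun hN => ?_⟩
  have hint := Quasimap.integrable_contourIntegrand hε' r hN
  -- Under absolute convergence the improper limit is also the Lebesgue integral, so the two limits
  -- agree.
  exact ⟨hint, tendsto_nhds_unique hlim
    ((MeasureTheory.intervalIntegral_tendsto_integral hint Filter.tendsto_fst
      Filter.tendsto_snd).const_mul _)⟩
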